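/- **Proposition (Tube Condition).** Let $G$ be a (finite-dimensional, real, smooth) Lie group with identity $e$, Lie algebra $\mathfrak g$ and dual $\mathfrak g^*$. Write $\langle \mathrm{Ad}_g^*\nu,\xi\rangle=\langle\nu,\mathrm{Ad}_g\xi\rangle$ and $\langle \mathrm{ad}_\xi^*\nu,\eta\rangle=\langle\nu,[\xi,\eta]\rangle$. Fix $\mu\in\mathfrak g^*$. Let $\mathfrak g_\mu=\{\xi\in\mathfrak g : \mathrm{ad}_\xi^*\mu=0\}$ be the isotropy algebra of $\mu$ for the coadjoint action, let $\mathfrak g_\mu^\perp$ be a linear complement of $\mathfrak g_\mu$ in $\mathfrak g$ (for example an orthogonal complement), and write $\xi^\mu$ for the $\mathfrak g_\mu$-component of $\xi\in\mathfrak g$. Elements $\nu\in\mathfrak g_\mu^*$ are regarded as elements of $\mathfrak g^*$ by $\langle\nu,\xi\rangle=\langle\nu,\xi^\mu\rangle$. Let $N=\{\mathrm{ad}_\eta^*\mu:\eta\in\mathfrak g\}\subset\mathfrak g^*$; the map $\mathfrak g_\mu^\perp\to N$, $\eta\mapsto\mathrm{ad}_\eta^*\mu$, is a linear isomorphism. Identify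 $T^*G\cong G\times\mathfrak g^*$ by left trivialisation, with canonical symplectic form $$\Omega_c(g,\alpha)\big((\xi_1,\rho_1),(\xi_2,\rho_2)\big)=\langle\alpha,[\xi_1,\xi_2]\rangle+\langle\rho_2,\xi_1\rangle-\langle\rho_1,\xi_2\rangle ,$$ where tangent vectors $v\in T_gG$ are written as $\xi=g^{-1}v\in\mathfrak g$. On $G\times\mathfrak g_\mu^*\times N$ let $\Omega_Y$ be the Marle–Guillemin–Sternberg model form $$\Omega_Y(g,\nu,\rho)\big((\xi_1,\dot\nu_1,\mathrm{ad}_{\zeta_1}^*\mu),(\xi_2,\dot\nu_2,\mathrm{ad}_{\zeta_2}^*\mu)\big)=\langle\mu+\nu,[\xi_1,\xi_2]\rangle+\langle\dot\nu_2,\xi_1^\mu\rangle-\langle\dot\nu_1,\xi_2^\mu\rangle-\langle\mu,[\zeta_1,\zeta_2]\rangle ,$$ with $\zeta_1,\zeta_2\in\mathfrak g_\mu^\perp$. The group $G$ acts on both spaces by left multiplication on the factor $G$. Let $U\subseteq\mathfrak g_\mu^*\times N$ be a connected open set containing $(0,0)$ (for instance the whole space), put $W=\{(\nu,\eta)\in\mathfrak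 g_\mu^*\times\mathfrak g_\mu^\perp:(\nu,\mathrm{ad}_\eta^*\mu)\in U\}$, and let $\Phi:G\times U\to G\times\mathfrak g^*$ be a smooth $G$-equivariant map with $\Phi(e,0,0)=(e,\mu)$. Then $\Phi^*\Omega_c=\Omega_Y$ on $G\times U$ if and only if there is a smooth map $F:W\to G$ with $F(0,0)=e$ such that $$\Phi(g,\nu,\mathrm{ad}_\eta^*\mu)=\big(g\,F(\nu,\eta)^{-1},\ \mathrm{Ad}_{F(\nu,\eta)^{-1}}^*(\mu+\nu)\big)\qquad\text{for all }g\in G,\ (\nu,\eta)\in W,$$ and such that, for all $(\nu,\eta)\in W$ and all $\dot\nu_1,\dot\nu_2\in\mathfrak g_\mu^*$, $\zeta_1,\zeta_2\in\mathfrak g_\mu^\perp$, with $\sigma_i=F(\nu,\eta)^{-1}\big(DF(\nu,\eta)\cdot(\dot\nu_i,\zeta_i)\big)\in\mathfrak g$, $$\langle\mu+\nu,[\sigma_1,\sigma_2]\rangle+\langle\dot\nu_2,\sigma_1\rangle-\langle\dot\nu_1,\sigma_2\rangle=\langle\mu,[\zeta_1,\zeta_2]\rangle .$$ -/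

import Mathlib

open scoped Manifold ContDiff

namespace TubeCondition

noncomputable section

/-- Over the reals, smoothness of class `minSmoothness ℝ 3 = 3` follows from `C^∞`; this makes
Mathlib's Lie bracket on the Lie algebra of a `C^∞` Lie group available. -/
instance instLEInftyMinSmoothnessThree : ENat.LEInfty (minSmoothness ℝ 3) :=
  ⟨by
    rw [minSmoothness_of_isRCLikeNormedField]
    exact ENat.LEInfty.out⟩

/-!
Throughout, `G` is a Lie group modelled on the finite-dimensional space `E`. In Mathlib the tangent
space of `G` at any point is, as a vector space, the model space `E`. So the Lie algebra
`𝔤 = T_1 G` has underlying vector space `E`, and its dual `𝔤*` is `StrongDual ℝ E`.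
-/

section LieGroup

variable {E : Type*} [NormedAddCommGroup E] [NormedSpace ℝ E] [FiniteDimensional ℝ E]
variable (G : Type*) [TopologicalSpace G] [ChartedSpace E G] [Group G]

/-- The Lie bracket `[ξ, η]` of the Lie algebra `𝔤 = T_1 G` (bracket of left-invariant vector
fields). -/
def br (ξ η : E) : E :=
  (⁅(show GroupLieAlgebra 𝓘(ℝ, E) G from ξ), (show GroupLieAlgebra 𝓘(ℝ, E) G from η)⁆ :
    GroupLieAlgebra 𝓘(ℝ, E) G)

variable {G} in
/-- Left trivialisation of the tangent bundle: `v ∈ T_g G` is sent to `g⁻¹ v ∈ T_1 G = 𝔤`. -/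
def leftTriv (g : G) (v : TangentSpace 𝓘(ℝ, E) g) : E :=
  mfderiv 𝓘(ℝ, E) 𝓘(ℝ, E) (fun x : G => g⁻¹ * x) g v

variable {G} in
/-- The adjoint action `Ad_g : 𝔤 → 𝔤`, the derivative at the identity of `x ↦ g x g⁻¹`. -/
def Ad (g : G) : E →L[ℝ] E :=
  mfderiv 𝓘(ℝ, E) 𝓘(ℝ, E) (fun x : G => g * x * g⁻¹) (1 : G)

variable {G} in
/-- `Ad_g^* : 𝔤* → 𝔤*`, `⟨Ad_g^* ν, ξ⟩ = ⟨ν, Ad_g ξ⟩`. -/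
def AdStar (g : G) (ν : StrongDual ℝ E) : StrongDual ℝ E :=
  ν.comp (Ad g)

variable {G} in
/-- The canonical symplectic form on `T*G ≅ G × 𝔤*` (left trivialisation) at the point `(g, α)`:
with `ξᵢ = g⁻¹ vᵢ`,
`Ω_c(g, α)((ξ₁, ρ₁), (ξ₂, ρ₂)) = ⟨α, [ξ₁, ξ₂]⟩ + ⟨ρ₂, ξ₁⟩ - ⟨ρ₁, ξ₂⟩`. -/
def omegaC (q : G × StrongDual ℝ E)
    (X₁ X₂ : TangentSpace (𝓘(ℝ, E).prod 𝓘(ℝ, StrongDual ℝ E)) q) : ℝ :=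
  let w₁ : E × StrongDual ℝ E := X₁
  let w₂ : E × StrongDual ℝ E := X₂
  let ξ₁ : E := leftTriv q.1 w₁.1
  let ξ₂ : E := leftTriv q.1 w₂.1
  q.2 (br G ξ₁ ξ₂) + w₂.2 ξ₁ - w₁.2 ξ₂

variable [LieGroup 𝓘(ℝ, E) ∞ G]

lemma br_add_left (ξ₁ ξ₂ η : E) : br G (ξ₁ + ξ₂) η = br G ξ₁ η + br G ξ₂ η := by
  have : CompleteSpace E := FiniteDimensional.complete ℝ E
  exact add_lie (show GroupLieAlgebra 𝓘(ℝ, E) G from ξ₁)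
    (show GroupLieAlgebra 𝓘(ℝ, E) G from ξ₂) (show GroupLieAlgebra 𝓘(ℝ, E) G from η)

lemma br_add_right (ξ η₁ η₂ : E) : br G ξ (η₁ + η₂) = br G ξ η₁ + br G ξ η₂ := by
  have : CompleteSpace E := FiniteDimensional.complete ℝ E
  exact lie_add (show GroupLieAlgebra 𝓘(ℝ, E) G from ξ)
    (show GroupLieAlgebra 𝓘(ℝ, E) G from η₁) (show GroupLieAlgebra 𝓘(ℝ, E) G from η₂)

lemma br_smul_left (c : ℝ) (ξ η : E) : br G (c • ξ) η = c • br G ξ η := by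
  have : CompleteSpace E := FiniteDimensional.complete ℝ E
  exact smul_lie c (show GroupLieAlgebra 𝓘(ℝ, E) G from ξ)
    (show GroupLieAlgebra 𝓘(ℝ, E) G from η)

lemma br_smul_right (c : ℝ) (ξ η : E) : br G ξ (c • η) = c • br G ξ η := by
  have : CompleteSpace E := FiniteDimensional.complete ℝ E
  exact lie_smul c (show GroupLieAlgebra 𝓘(ℝ, E) G from ξ)
    (show GroupLieAlgebra 𝓘(ℝ, E) G from η)

/-- For fixed `μ ∈ 𝔤*`, the linear map `ξ ↦ ad_ξ^* μ`, where `⟨ad_ξ^* μ, η⟩ = ⟨μ, [ξ, η]⟩`. -/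
def adStar (μ : StrongDual ℝ E) : E →ₗ[ℝ] StrongDual ℝ E where
  toFun ξ := LinearMap.toContinuousLinearMap
    { toFun := fun η => μ (br G ξ η)
      map_add' := fun η₁ η₂ => by rw [br_add_right, map_add]
      map_smul' := fun c η => by rw [br_smul_right, map_smul]; rfl }
  map_add' ξ₁ ξ₂ := by
    ext η
    simp [br_add_left]
  map_smul' c ξ := by
    ext η
    simp [br_smul_left]

@[simp] lemma adStar_apply (μ : StrongDual ℝ E) (ξ η : E) :
    adStar G μ ξ η = μ (br G ξ η) := rfl

/-- The isotropy subalgebra `𝔤_μ = {ξ | ad_ξ^* μ = 0}` of the coadjoint action at `μ`. -/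
def isotropy (μ : StrongDual ℝ E) : Submodule ℝ E := LinearMap.ker (adStar G μ)

/-- The space `N = T_μ 𝒪_μ = {ad_η^* μ | η ∈ 𝔤} ⊆ 𝔤*`, the tangent space at `μ` of the coadjoint
orbit, which serves as symplectic normal space. -/
def normalSpace (μ : StrongDual ℝ E) : Submodule ℝ (StrongDual ℝ E) :=
  LinearMap.range (adStar G μ)

/-- For a complement `P = 𝔤_μ^⊥` of `𝔤_μ` in `𝔤`, the linear map `P → N`, `η ↦ ad_η^* μ`. -/
def toNormal (μ : StrongDual ℝ E) (P : Submodule ℝ E) : P →ₗ[ℝ] normalSpace G μ :=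
  (adStar G μ).rangeRestrict.comp P.subtype

@[simp] lemma coe_toNormal (μ : StrongDual ℝ E) (P : Submodule ℝ E) (η : P) :
    (toNormal G μ P η : StrongDual ℝ E) = adStar G μ η := rfl

variable {G} {μ : StrongDual ℝ E} {P : Submodule ℝ E}

lemma toNormal_bijective (hP : IsCompl (isotropy G μ) P) :
    Function.Bijective (toNormal G μ P) := by
  constructor
  · refine (injective_iff_map_eq_zero _).2 fun η hη => ?_
    have h1 : (η : E) ∈ isotropy G μ := by
      have := congrArg Subtype.val hη
      simpa [isotropy] using this
    have h2 := hP.disjoint.le_bot ⟨h1, η.2⟩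
    exact Subtype.ext (by simpa using h2)
  · rintro ⟨_, ξ, rfl⟩
    have hξ : ξ ∈ isotropy G μ ⊔ P := by rw [hP.sup_eq_top]; trivial
    obtain ⟨a, ha, b, hb, rfl⟩ := Submodule.mem_sup.1 hξ
    refine ⟨⟨b, hb⟩, Subtype.ext ?_⟩
    have ha' : adStar G μ a = 0 := ha
    simp [ha']

/-- The linear isomorphism `𝔤_μ^⊥ ≃ N`, `η ↦ ad_η^* μ`. -/
def normalEquiv (hP : IsCompl (isotropy G μ) P) : P ≃ₗ[ℝ] normalSpace G μ :=
  LinearEquiv.ofBijective (toNormal G μ P) (toNormal_bijective hP)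

/-- A functional `ν ∈ 𝔤_μ^*` regarded as an element of `𝔤*` by means of the splitting
`𝔤 = 𝔤_μ ⊕ 𝔤_μ^⊥`: it is extended by zero on `𝔤_μ^⊥`, so that `⟨ν, ξ⟩ = ⟨ν, ξ^μ⟩` with `ξ^μ` the
`𝔤_μ` component of `ξ`. -/
def extend (hP : IsCompl (isotropy G μ) P) (ν : StrongDual ℝ (isotropy G μ)) : StrongDual ℝ E :=
  ν.comp (LinearMap.toContinuousLinearMap ((isotropy G μ).projectionOnto P hP))

variable (G) in
/-- The vector space `𝔤_μ^* × N`. -/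
abbrev Slice (μ : StrongDual ℝ E) : Type _ := StrongDual ℝ (isotropy G μ) × normalSpace G μ

/-- `Ω_T((ξ₁, ν̇₁, ρ̇₁), (ξ₂, ν̇₂, ρ̇₂)) = ⟨μ, [ξ₁, ξ₂]⟩` on `G × 𝔤_μ^* × N`, in left trivialisation:
`ξᵢ = g⁻¹ vᵢ`. -/
def omegaT (p : G × Slice G μ)
    (X₁ X₂ : TangentSpace (𝓘(ℝ, E).prod 𝓘(ℝ, Slice G μ)) p) : ℝ :=
  let w₁ : E × Slice G μ := X₁
  let w₂ : E × Slice G μ := X₂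
  μ (br G (leftTriv p.1 w₁.1) (leftTriv p.1 w₂.1))

/-- `Ω_0(g, ν, ρ)((ξ₁, ν̇₁, ρ̇₁), (ξ₂, ν̇₂, ρ̇₂)) = ⟨ν, [ξ₁, ξ₂]⟩ + ⟨ν̇₂, ξ₁^μ⟩ - ⟨ν̇₁, ξ₂^μ⟩` on
`G × 𝔤_μ^* × N`, in left trivialisation. -/
def omega0 (hP : IsCompl (isotropy G μ) P) (p : G × Slice G μ)
    (X₁ X₂ : TangentSpace (𝓘(ℝ, E).prod 𝓘(ℝ, Slice G μ)) p) : ℝ :=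
  let w₁ : E × Slice G μ := X₁
  let w₂ : E × Slice G μ := X₂
  let ξ₁ : E := leftTriv p.1 w₁.1
  let ξ₂ : E := leftTriv p.1 w₂.1
  extend hP p.2.1 (br G ξ₁ ξ₂)
    + w₂.2.1 ((isotropy G μ).projectionOnto P hP ξ₁)
    - w₁.2.1 ((isotropy G μ).projectionOnto P hP ξ₂)

/-- `Ω_N((ξ₁, ν̇₁, ad_{ζ₁}^* μ), (ξ₂, ν̇₂, ad_{ζ₂}^* μ)) = -⟨μ, [ζ₁, ζ₂]⟩` on `G × 𝔤_μ^* × N`, with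
`ζᵢ ∈ 𝔤_μ^⊥`. -/
def omegaN (hP : IsCompl (isotropy G μ) P) (p : G × Slice G μ)
    (X₁ X₂ : TangentSpace (𝓘(ℝ, E).prod 𝓘(ℝ, Slice G μ)) p) : ℝ :=
  let w₁ : E × Slice G μ := X₁
  let w₂ : E × Slice G μ := X₂;
  -μ (br G ((normalEquiv hP).symm w₁.2.2 : E) ((normalEquiv hP).symm w₂.2.2 : E))

/-- The Marle-Guillemin-Sternberg model form `Ω_Y = Ω_T + Ω_0 + Ω_N` on `G × 𝔤_μ^* × N`. -/
def omegaY (hP : IsCompl (isotropy G μ) P) (p : G × Slice G μ)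
    (X₁ X₂ : TangentSpace (𝓘(ℝ, E).prod 𝓘(ℝ, Slice G μ)) p) : ℝ :=
  omegaT p X₁ X₂ + omega0 hP p X₁ X₂ + omegaN hP p X₁ X₂

variable (P) in
/-- The set of `(ν, η) ∈ 𝔤_μ^* × 𝔤_μ^⊥` such that `(ν, ad_η^* μ) ∈ U`. -/
def paramDomain (U : Set (Slice G μ)) : Set (StrongDual ℝ (isotropy G μ) × P) :=
  {x | (x.1, toNormal G μ P x.2) ∈ U}

/-- `F(ν, η)⁻¹ (DF(ν, η) · (ν̇, ζ)) ∈ 𝔤` for `F : 𝔤_μ^* × 𝔤_μ^⊥ → G`. -/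
def leftLogDeriv (F : StrongDual ℝ (isotropy G μ) × P → G)
    (x v : StrongDual ℝ (isotropy G μ) × P) : E :=
  leftTriv (F x)
    (mfderiv 𝓘(ℝ, StrongDual ℝ (isotropy G μ) × P) 𝓘(ℝ, E) F x v)

end LieGroup

end

end TubeCondition

/-! Equivariance makes `Φ` a function of its restriction to the slice through the identity. With `f
= sliceGroup Φ` and `β = sliceMomentum Φ` one has `Φ(g, y) = (g f(y)⁻¹, Ad_{f(y)⁻¹}^* β(y))`
(`eq_sliceGroup_sliceMomentum`).

Write `S = f⁻¹ Df`, `B = Dβ`, and let `(ξᵢ, vᵢ)` be tangent vectors. Then `omegaC_mfderiv` gives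
`Φ^*Ω_c = β[ξ₁, ξ₂] - β[S v₁, S v₂] + (B v₂)(ξ₁ - S v₁) - (B v₁)(ξ₂ - S v₂)`. The Lie-theoretic
input is that the bracket is the derivative of `Ad` at the identity (`hasDerivMap_Ad_one`) and is
preserved by `Ad` (`brL_Ad`).

The model form has the shape `(μ + L y)[ξ₁, ξ₂] + (L v₂) ξ₁ - (L v₁) ξ₂ - κ(v₁, v₂)`, with `L` the
extension of functionals from `𝔤_μ` and `κ` the pairing of `μ` with the bracket. Pairing a group
direction with a slice direction forces `Dβ = L`. Since `U` is connected and `β(0) = μ`, this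
integrates to `β = μ + L`. What remains on pairs of slice directions is exactly the tube equation.
Conversely, these two conditions make the forms agree term by term. This is
`pullback_omegaC_eq_iff`; the rest transports it along the isomorphism `𝔤_μ^⊥ ≃ N`. -/

namespace TubeCondition

noncomputable section

/-! ### Calculus of derivatives as maps between model spaces -/

section DerivMap

variable {V H M : Type*} [NormedAddCommGroup V] [NormedSpace ℝ V] [TopologicalSpace H]
  {J : ModelWithCorners ℝ V H} [TopologicalSpace M] [ChartedSpace H M]
variable {V' H' M' : Type*} [NormedAddCommGroup V'] [NormedSpace ℝ V'] [TopologicalSpace H']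
  {J' : ModelWithCorners ℝ V' H'} [TopologicalSpace M'] [ChartedSpace H' M']
variable {V'' H'' M'' : Type*} [NormedAddCommGroup V''] [NormedSpace ℝ V''] [TopologicalSpace H'']
  {J'' : ModelWithCorners ℝ V'' H''} [TopologicalSpace M''] [ChartedSpace H'' M'']

/-- `HasMFDerivAt` for a derivative given as a linear map between the model vector spaces. -/
def HasDerivMap (J : ModelWithCorners ℝ V H) (J' : ModelWithCorners ℝ V' H')
    (f : M → M') (x : M) (A : V →L[ℝ] V') : Prop :=
  HasMFDerivAt J J' f x A

lemma HasDerivMap.comp {f : M → M'} {g : M' → M''} {x : M} {y : M'} {A : V →L[ℝ] V'}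
    {B : V' →L[ℝ] V''} (hg : HasDerivMap J' J'' g y B) (hf : HasDerivMap J J' f x A)
    (hy : f x = y) : HasDerivMap J J'' (fun z => g (f z)) x (B.comp A) := by
  subst hy
  exact HasMFDerivAt.comp x hg hf

lemma HasDerivMap.prodMk {f : M → M'} {g : M → M''} {x : M} {A : V →L[ℝ] V'} {B : V →L[ℝ] V''}
    (hf : HasDerivMap J J' f x A) (hg : HasDerivMap J J'' g x B) :
    HasDerivMap J (J'.prod J'') (fun z => (f z, g z)) x (A.prod B) :=
  HasMFDerivAt.prodMk hf hg

lemma hasDerivMap_fst (p : M × M') :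
    HasDerivMap (J.prod J') J Prod.fst p (ContinuousLinearMap.fst ℝ V V') :=
  hasMFDerivAt_fst p

lemma hasDerivMap_snd (p : M × M') :
    HasDerivMap (J.prod J') J' Prod.snd p (ContinuousLinearMap.snd ℝ V V') :=
  hasMFDerivAt_snd p

lemma hasDerivMap_id (x : M) : HasDerivMap J J (fun z : M => z) x (ContinuousLinearMap.id ℝ V) :=
  hasMFDerivAt_id x

lemma hasDerivMap_const (x : M) (y : M') : HasDerivMap J J' (fun _ : M => y) x 0 :=
  hasMFDerivAt_const y x

lemma HasDerivMap.unique {f : M → M'} {x : M} {A B : V →L[ℝ] V'}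
    (hA : HasDerivMap J J' f x A) (hB : HasDerivMap J J' f x B) : A = B :=
  hasMFDerivAt_unique hA hB

lemma HasDerivMap.congr {f g : M → M'} {x : M} {A : V →L[ℝ] V'}
    (hf : HasDerivMap J J' f x A) (h : g =ᶠ[nhds x] f) : HasDerivMap J J' g x A :=
  HasMFDerivAt.congr_of_eventuallyEq hf h

lemma HasDerivMap.mfderiv_eq {f : M → M'} {x : M} {A : V →L[ℝ] V'}
    (hf : HasDerivMap J J' f x A) : mfderiv J J' f x = A :=
  HasMFDerivAt.mfderiv hf

lemma _root_.MDifferentiableAt.hasDerivMap {f : M → M'} {x : M} (hf : MDifferentiableAt J J' f x) :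
    HasDerivMap J J' f x (mfderiv J J' f x) := hf.hasMFDerivAt

lemma hasDerivMap_iff_hasFDerivAt {f : V → V'} {x : V} {A : V →L[ℝ] V'} :
    HasDerivMap 𝓘(ℝ, V) 𝓘(ℝ, V') f x A ↔ HasFDerivAt f A x :=
  hasMFDerivAt_iff_hasFDerivAt

/-- The total derivative exists by assumption, so the chain rule along the two slice inclusions
identifies its restrictions with the partial derivatives. -/
lemma HasDerivMap.of_partial {f : M × M' → M''} {x : M} {y : M'} {A : V →L[ℝ] V''}
    {B : V' →L[ℝ] V''} (hf : MDifferentiableAt (J.prod J') J'' f (x, y))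
    (hA : HasDerivMap J J'' (fun z => f (z, y)) x A)
    (hB : HasDerivMap J' J'' (fun z => f (x, z)) y B) :
    HasDerivMap (J.prod J') J'' f (x, y)
      (A.comp (ContinuousLinearMap.fst ℝ V V') + B.comp (ContinuousLinearMap.snd ℝ V V')) := by
  obtain ⟨D, h⟩ : ∃ D : V × V' →L[ℝ] V'', HasDerivMap (J.prod J') J'' f (x, y) D :=
    ⟨_, hf.hasDerivMap⟩
  have hA' := hA.unique (h.comp ((hasDerivMap_id x).prodMk (hasDerivMap_const x y)) rfl)
  have hB' := hB.unique (h.comp ((hasDerivMap_const y x).prodMk (hasDerivMap_id y)) rfl)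
  subst hA' hB'
  convert h using 1
  refine ContinuousLinearMap.ext fun v => ?_
  have : v = (v.1, 0) + (0, v.2) := by simp
  conv_rhs => rw [this, map_add]
  simp

end DerivMap

/-! ### The adjoint action and left logarithmic derivatives -/

section Adjoint

variable {E : Type*} [NormedAddCommGroup E] [NormedSpace ℝ E]
variable {G : Type*} [TopologicalSpace G] [ChartedSpace E G] [Group G]

/-- `HasLogDerivAt J p x A` says that `A : V → 𝔤` is the left logarithmic derivative
`p(x)⁻¹ Dp(x)` of `p : M → G` at `x`. -/
def HasLogDerivAt {V H M : Type*} [NormedAddCommGroup V] [NormedSpace ℝ V] [TopologicalSpace H]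
    (J : ModelWithCorners ℝ V H) [TopologicalSpace M] [ChartedSpace H M]
    (p : M → G) (x : M) (A : V →L[ℝ] E) : Prop :=
  HasDerivMap J 𝓘(ℝ, E) (fun y => (p x)⁻¹ * p y) x A

variable {V H M : Type*} [NormedAddCommGroup V] [NormedSpace ℝ V] [TopologicalSpace H]
  {J : ModelWithCorners ℝ V H} [TopologicalSpace M] [ChartedSpace H M]
variable {V' H' M' : Type*} [NormedAddCommGroup V'] [NormedSpace ℝ V'] [TopologicalSpace H']
  {J' : ModelWithCorners ℝ V' H'} [TopologicalSpace M'] [ChartedSpace H' M']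

lemma HasLogDerivAt.unique {p : M → G} {x : M} {A B : V →L[ℝ] E}
    (hp : HasLogDerivAt J p x A) (hq : HasLogDerivAt J p x B) : A = B :=
  HasDerivMap.unique hp hq

lemma HasLogDerivAt.congr {p q : M → G} {x : M} {A : V →L[ℝ] E}
    (hp : HasLogDerivAt J p x A) (h : q =ᶠ[nhds x] p) : HasLogDerivAt J q x A := by
  refine HasDerivMap.congr hp (h.mono fun y hy => ?_)
  simp only [hy, h.self_of_nhds]

lemma HasLogDerivAt.comp {p : M' → G} {f : M → M'} {x : M} {y : M'} {A : V' →L[ℝ] E}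
    {B : V →L[ℝ] V'}
    (hp : HasLogDerivAt J' p y A) (hf : HasDerivMap J J' f x B) (hy : f x = y) :
    HasLogDerivAt J (fun z => p (f z)) x (A.comp B) := by
  have := HasDerivMap.comp hp hf hy
  subst hy
  exact this

lemma hasLogDerivAt_const (x : M) (g : G) : HasLogDerivAt J (fun _ : M => g) x (0 : V →L[ℝ] E) :=
  hasDerivMap_const _ _

/-- `leftTriv g` as a continuous linear map. -/
def leftTrivL (g : G) : E →L[ℝ] E :=
  mfderiv 𝓘(ℝ, E) 𝓘(ℝ, E) (fun x : G => g⁻¹ * x) g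

lemma AdStar_apply (g : G) (ν : StrongDual ℝ E) (ξ : E) : AdStar g ν ξ = ν (Ad g ξ) := rfl

variable [LieGroup 𝓘(ℝ, E) ∞ G]

lemma hasDerivMap_conj (g : G) :
    HasDerivMap 𝓘(ℝ, E) 𝓘(ℝ, E) (fun x : G => g * x * g⁻¹) 1 (Ad (E := E) g) := by
  have h : ContMDiff 𝓘(ℝ, E) 𝓘(ℝ, E) ∞ (fun x : G => g * x * g⁻¹) :=
    (contMDiff_const.mul contMDiff_id).mul contMDiff_const
  exact (h.mdifferentiableAt (by simp)).hasMFDerivAt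

lemma mdifferentiableAt_mul_left (g h : G) :
    MDifferentiableAt 𝓘(ℝ, E) 𝓘(ℝ, E) (fun x : G => g * x) h := by
  have : ContMDiff 𝓘(ℝ, E) 𝓘(ℝ, E) ∞ (fun x : G => g * x) := contMDiff_const.mul contMDiff_id
  exact this.mdifferentiableAt (by simp)

lemma hasDerivMap_mul_one :
    HasDerivMap (𝓘(ℝ, E).prod 𝓘(ℝ, E)) 𝓘(ℝ, E) (fun x : G × G => x.1 * x.2) (1, 1)
      (ContinuousLinearMap.fst ℝ E E + ContinuousLinearMap.snd ℝ E E : E × E →L[ℝ] E) := by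
  have h : ContMDiff (𝓘(ℝ, E).prod 𝓘(ℝ, E)) 𝓘(ℝ, E) ∞ (fun x : G × G => x.1 * x.2) :=
    contMDiff_fst.mul contMDiff_snd
  have h1 := h.mdifferentiableAt (x := (1, 1)) (by simp)
  refine HasDerivMap.of_partial (A := ContinuousLinearMap.id ℝ E) (B := ContinuousLinearMap.id ℝ E)
    h1 ?_ ?_
  · simpa using hasDerivMap_id (1 : G)
  · simpa using hasDerivMap_id (1 : G)

lemma Ad_one : Ad (1 : G) = ContinuousLinearMap.id ℝ E := by
  refine (hasDerivMap_conj (E := E) (1 : G)).unique ?_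
  simpa using hasDerivMap_id (1 : G)

lemma Ad_mul (g h : G) : Ad (E := E) (g * h) = (Ad g).comp (Ad h) := by
  refine (hasDerivMap_conj (E := E) (g * h)).unique ?_
  have h1 := (hasDerivMap_conj (E := E) g).comp (hasDerivMap_conj (E := E) h) (by simp)
  have : (fun x : G => g * h * x * (g * h)⁻¹) = fun x => g * (h * x * h⁻¹) * g⁻¹ := by
    ext x; group
  rwa [this]

lemma Ad_inv_comp (g : G) : (Ad (E := E) g⁻¹).comp (Ad g) = ContinuousLinearMap.id ℝ E := by
  rw [← Ad_mul, inv_mul_cancel, Ad_one]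

lemma Ad_comp_inv (g : G) : (Ad (E := E) g).comp (Ad g⁻¹) = ContinuousLinearMap.id ℝ E := by
  rw [← Ad_mul, mul_inv_cancel, Ad_one]

@[simp] lemma Ad_inv_apply (g : G) (ξ : E) : Ad g⁻¹ (Ad g ξ) = ξ :=
  DFunLike.congr_fun (Ad_inv_comp g) ξ

@[simp] lemma Ad_apply_inv (g : G) (ξ : E) : Ad g (Ad g⁻¹ ξ) = ξ :=
  DFunLike.congr_fun (Ad_comp_inv g) ξ

lemma HasDerivMap.hasLogDerivAt {p : M → G} {x : M} {A : V →L[ℝ] E}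
    (hp : HasDerivMap J 𝓘(ℝ, E) p x A) : HasLogDerivAt J p x ((leftTrivL (p x)).comp A) :=
  HasDerivMap.comp (mdifferentiableAt_mul_left (E := E) (p x)⁻¹ (p x)).hasDerivMap hp rfl

lemma leftTrivL_bijective (g : G) : Function.Bijective (leftTrivL (E := E) g) := by
  have h1 := (mdifferentiableAt_mul_left (E := E) g 1).hasDerivMap
  have h2 := (mdifferentiableAt_mul_left (E := E) g⁻¹ g).hasDerivMap
  have h12 := h2.comp h1 (mul_one g)
  have h21 := h1.comp h2 (inv_mul_cancel g)
  simp only [inv_mul_cancel_left, mul_inv_cancel_left] at h12 h21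
  have e12 := h12.unique (hasDerivMap_id _)
  have e21 := h21.unique (hasDerivMap_id _)
  exact Function.bijective_iff_has_inverse.2 ⟨_, DFunLike.congr_fun e21, DFunLike.congr_fun e12⟩

/-- Factor `(p(x) q(x))⁻¹ p(y) q(y)` as `q(x)⁻¹ (p(x)⁻¹ p(y)) q(x)` times `q(x)⁻¹ q(y)`. Both
factors pass through the identity at `y = x`, where multiplication has derivative the sum. -/
lemma HasLogDerivAt.mul {p q : M → G} {x : M} {A B : V →L[ℝ] E}
    (hp : HasLogDerivAt J p x A) (hq : HasLogDerivAt J q x B) :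
    HasLogDerivAt J (fun y => p y * q y) x ((Ad (q x)⁻¹).comp A + B) := by
  have h1 := (hasDerivMap_conj (E := E) (q x)⁻¹).comp hp (by simp)
  have h3 := (hasDerivMap_mul_one (E := E) (G := G)).comp (h1.prodMk hq) (by simp)
  unfold HasLogDerivAt
  convert! h3 using 2
  group

/-- The product `p p⁻¹` is constant, so the product rule gives `Ad_{p(x)} A + B = 0`. -/
lemma HasLogDerivAt.inv {p : M → G} {x : M} {A B : V →L[ℝ] E}
    (hp : HasLogDerivAt J p x A) (hq : HasLogDerivAt J (fun y => (p y)⁻¹) x B) :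
    B = -(Ad (p x)).comp A := by
  have h := hp.mul hq
  simp only [mul_inv_cancel, inv_inv] at h
  rw [eq_neg_iff_add_eq_zero, add_comm]
  exact h.unique (hasLogDerivAt_const x 1)

end Adjoint

/-! ### The bracket as the derivative of `Ad` at the identity -/

section AdjointDerivative

variable {E : Type*} [NormedAddCommGroup E] [NormedSpace ℝ E]
variable (G : Type*) [TopologicalSpace G] [ChartedSpace E G] [Group G]

/-- The multiplication of `G`, read in the preferred chart at `1`. -/
def chartMul (z : E × E) : E :=
  extChartAt 𝓘(ℝ, E) (1 : G)
    ((extChartAt 𝓘(ℝ, E) (1 : G)).symm z.1 * (extChartAt 𝓘(ℝ, E) (1 : G)).symm z.2)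

/-- The left-invariant vector field through `v`, read in the preferred chart at `1`. -/
def invariantFieldInChart (v : E) : E → E :=
  VectorField.mpullbackWithin 𝓘(ℝ, E) 𝓘(ℝ, E) (extChartAt 𝓘(ℝ, E) (1 : G)).symm
    (mulInvariantVectorField (I := 𝓘(ℝ, E)) (G := G) v) (Set.range 𝓘(ℝ, E))

lemma eventually_mem_extChartAt_one_target :
    ∀ᶠ x in nhds (extChartAt 𝓘(ℝ, E) (1 : G) 1), x ∈ (extChartAt 𝓘(ℝ, E) (1 : G)).target :=
  extChartAt_target_mem_nhds (I := 𝓘(ℝ, E)) (1 : G)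

variable [LieGroup 𝓘(ℝ, E) ∞ G]

lemma hasDerivMap_extChartAt_self :
    HasDerivMap 𝓘(ℝ, E) 𝓘(ℝ, E) (extChartAt 𝓘(ℝ, E) (1 : G)) 1 (ContinuousLinearMap.id ℝ E) := by
  have : IsManifold 𝓘(ℝ, E) 1 G := IsManifold.of_le (n := ∞) (by simp)
  have h := (mdifferentiableAt_extChartAt (I := 𝓘(ℝ, E)) (mem_chart_source E (1 : G))).hasDerivMap
  rwa [mfderiv_extChartAt_self] at h

lemma hasDerivMap_extChartAt_symm_self :
    HasDerivMap 𝓘(ℝ, E) 𝓘(ℝ, E) (extChartAt 𝓘(ℝ, E) (1 : G)).symm (extChartAt 𝓘(ℝ, E) (1 : G) 1)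
      (ContinuousLinearMap.id ℝ E) := by
  have : IsManifold 𝓘(ℝ, E) 1 G := IsManifold.of_le (n := ∞) (by simp)
  have h := (mdifferentiableWithinAt_extChartAt_symm (I := 𝓘(ℝ, E))
    (mem_extChartAt_target (I := 𝓘(ℝ, E)) (1 : G))).hasMFDerivWithinAt
  rw [mfderivWithin_range_extChartAt_symm, modelWithCornersSelf_coe, Set.range_id] at h
  exact hasMFDerivWithinAt_univ.1 h

lemma contDiffAt_chartMul :
    ContDiffAt ℝ ∞ (chartMul G)
      (extChartAt 𝓘(ℝ, E) (1 : G) 1, extChartAt 𝓘(ℝ, E) (1 : G) 1) := by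
  rw [← contMDiffAt_iff_contDiffAt]
  have hs : ContMDiffAt 𝓘(ℝ, E) 𝓘(ℝ, E) ∞ (extChartAt 𝓘(ℝ, E) (1 : G)).symm
      (extChartAt 𝓘(ℝ, E) (1 : G) 1) :=
    (contMDiffOn_extChartAt_symm (1 : G)).contMDiffAt (extChartAt_target_mem_nhds (1 : G))
  have h1 : ContMDiffAt 𝓘(ℝ, E × E) 𝓘(ℝ, E) ∞
      (fun z : E × E => (extChartAt 𝓘(ℝ, E) (1 : G)).symm z.1
        * (extChartAt 𝓘(ℝ, E) (1 : G)).symm z.2)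
      (extChartAt 𝓘(ℝ, E) (1 : G) 1, extChartAt 𝓘(ℝ, E) (1 : G) 1) :=
    (hs.comp_of_eq contDiffAt_fst.contMDiffAt rfl).mul
      (hs.comp_of_eq contDiffAt_snd.contMDiffAt rfl)
  exact (contMDiffAt_extChartAt (I := 𝓘(ℝ, E)) (x := (1 : G))).comp_of_eq h1 (by simp)

/-- Differentiating the smooth map `(g, x) ↦ g x g⁻¹` in `x` at `1` depends smoothly on `g`.
Conjugation fixes `1`, so source and target base points are constant and the tangent coordinate
changes are the identity. -/
lemma contMDiffAt_Ad_one :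
    ContMDiffAt 𝓘(ℝ, E) 𝓘(ℝ, E →L[ℝ] E) 1 (fun g : G => Ad (E := E) g) 1 := by
  have : IsManifold 𝓘(ℝ, E) 1 G := IsManifold.of_le (n := ∞) (by simp)
  have hf : ContMDiffAt (𝓘(ℝ, E).prod 𝓘(ℝ, E)) 𝓘(ℝ, E) ∞
      (Function.uncurry fun (g x : G) => g * x * g⁻¹) (1, 1) :=
    ((contMDiffAt_fst.mul contMDiffAt_snd).mul contMDiffAt_fst.inv)
  have h := ContMDiffAt.mfderiv (m := 1) (J := 𝓘(ℝ, E)) (fun (g x : G) => g * x * g⁻¹)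
    (fun _ => (1 : G)) hf contMDiffAt_const (by norm_cast)
  have hb : (fun g : G => g * 1 * g⁻¹) = fun _ => 1 := by simp
  rw [hb] at h
  have hs : ∀ w : E, (tangentBundleCore 𝓘(ℝ, E) G).coordChange (achart E (1 : G))
      (achart E (1 : G)) 1 w = w := fun w =>
    (tangentBundleCore 𝓘(ℝ, E) G).coordChange_self (achart E (1 : G)) 1
      (mem_chart_source E (1 : G)) w
  have key : ∀ ϕ : G → E →L[ℝ] E,
      inTangentCoordinates 𝓘(ℝ, E) 𝓘(ℝ, E) (fun _ => (1 : G)) (fun _ => (1 : G)) ϕ 1 = ϕ := by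
    intro ϕ
    ext g v
    have h := inTangentCoordinates_eq (I := 𝓘(ℝ, E)) (I' := 𝓘(ℝ, E)) (fun _ : G => (1 : G))
      (fun _ : G => (1 : G)) ϕ (x₀ := 1) (x := g) (mem_chart_source E (1 : G))
      (mem_chart_source E (1 : G))
    rw [h]
    simp only [ContinuousLinearMap.comp_apply, hs]
  have h' : ContMDiffAt 𝓘(ℝ, E) 𝓘(ℝ, E →L[ℝ] E) 1
      (inTangentCoordinates 𝓘(ℝ, E) 𝓘(ℝ, E) (fun _ => (1 : G)) (fun _ => (1 : G))
        (fun g : G => Ad (E := E) g) 1) 1 := h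
  rwa [key] at h'

lemma fderiv_chartMul_inr {x : E}
    (hx : DifferentiableAt ℝ (chartMul G) (x, extChartAt 𝓘(ℝ, E) (1 : G) 1)) (w : E)
    {A B : E →L[ℝ] E}
    (hA : HasDerivMap 𝓘(ℝ, E) 𝓘(ℝ, E) (fun h => (extChartAt 𝓘(ℝ, E) (1 : G)).symm x * h) 1 A)
    (hB : HasDerivMap 𝓘(ℝ, E) 𝓘(ℝ, E) (extChartAt 𝓘(ℝ, E) (1 : G))
      ((extChartAt 𝓘(ℝ, E) (1 : G)).symm x) B) :
    fderiv ℝ (chartMul G) (x, extChartAt 𝓘(ℝ, E) (1 : G) 1) (0, w) = B (A w) := by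
  have h1 := (hB.comp hA (mul_one _)).comp (hasDerivMap_extChartAt_symm_self G) (by simp)
  have h2 := hx.hasFDerivAt.comp (extChartAt 𝓘(ℝ, E) (1 : G) 1)
    (hasFDerivAt_prodMk_right (𝕜 := ℝ) x (extChartAt 𝓘(ℝ, E) (1 : G) 1))
  have := DFunLike.congr_fun ((hasDerivMap_iff_hasFDerivAt.2 h2).unique h1) w
  simpa using this

lemma fderiv_chartMul_inl {x : E}
    (hx : DifferentiableAt ℝ (chartMul G) (extChartAt 𝓘(ℝ, E) (1 : G) 1, x)) (w : E)
    {A : E →L[ℝ] E}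
    (hA : HasDerivMap 𝓘(ℝ, E) 𝓘(ℝ, E) (fun h =>
      extChartAt 𝓘(ℝ, E) (1 : G) (h * (extChartAt 𝓘(ℝ, E) (1 : G)).symm x)) 1 A) :
    fderiv ℝ (chartMul G) (extChartAt 𝓘(ℝ, E) (1 : G) 1, x) (w, 0) = A w := by
  have h1 := hA.comp (hasDerivMap_extChartAt_symm_self G) (by simp)
  have h2 := hx.hasFDerivAt.comp (extChartAt 𝓘(ℝ, E) (1 : G) 1)
    (hasFDerivAt_prodMk_left (𝕜 := ℝ) (extChartAt 𝓘(ℝ, E) (1 : G) 1) x)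
  have := DFunLike.congr_fun ((hasDerivMap_iff_hasFDerivAt.2 h2).unique h1) w
  simpa using this

/-- The left-invariant field at `g` is the derivative of `h ↦ g h` at `1`; in the chart this is the
partial derivative of multiplication in its second argument. -/
lemma eventually_invariantFieldInChart_eq (v : E) :
    invariantFieldInChart G v
      =ᶠ[nhds (extChartAt 𝓘(ℝ, E) (1 : G) 1)]
    fun x => fderiv ℝ (chartMul G) (x, extChartAt 𝓘(ℝ, E) (1 : G) 1) (0, v) := by
  have : IsManifold 𝓘(ℝ, E) 1 G := IsManifold.of_le (n := ∞) (by simp)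
  have hd : ∀ᶠ x in nhds (extChartAt 𝓘(ℝ, E) (1 : G) 1),
      DifferentiableAt ℝ (chartMul G) (x, extChartAt 𝓘(ℝ, E) (1 : G) 1) := by
    have h := ((contDiffAt_chartMul (E := E) G).of_le (m := 1) (by simp)).eventually (by simp)
    have hc : ContinuousAt (fun x : E => (x, extChartAt 𝓘(ℝ, E) (1 : G) 1))
      (extChartAt 𝓘(ℝ, E) (1 : G) 1) := by
      fun_prop
    exact (hc.eventually h).mono fun x hx => hx.differentiableAt (by simp)
  filter_upwards [hd, eventually_mem_extChartAt_one_target G] with x hx hxt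
  have hsrc := (extChartAt 𝓘(ℝ, E) (1 : G)).map_target hxt
  rw [fderiv_chartMul_inr G hx v (mdifferentiableAt_mul_left (E := E) _ _).hasDerivMap
    (mdifferentiableAt_extChartAt (I := 𝓘(ℝ, E)) (by simpa using hsrc)).hasDerivMap]
  unfold invariantFieldInChart
  rw [VectorField.mpullbackWithin_apply, ContinuousLinearMap.inverse_eq
    (mfderivWithin_extChartAt_symm_comp_mfderiv_extChartAt hxt)
    (mfderiv_extChartAt_comp_mfderivWithin_extChartAt_symm hxt)]
  rfl

lemma hasFDerivAt_fderiv_chartMul :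
    HasFDerivAt (fderiv ℝ (chartMul G)) (fderiv ℝ (fderiv ℝ (chartMul G))
      (extChartAt 𝓘(ℝ, E) (1 : G) 1, extChartAt 𝓘(ℝ, E) (1 : G) 1))
      (extChartAt 𝓘(ℝ, E) (1 : G) 1, extChartAt 𝓘(ℝ, E) (1 : G) 1) := by
  have h1 : ContDiffAt ℝ 1 (fderiv ℝ (chartMul G))
      (extChartAt 𝓘(ℝ, E) (1 : G) 1, extChartAt 𝓘(ℝ, E) (1 : G) 1) :=
    (contDiffAt_chartMul G).fderiv_right (by norm_cast)
  exact (h1.differentiableAt (by simp)).hasFDerivAt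

lemma fderiv_fderiv_chartMul_inr (v w : E) :
    fderiv ℝ (fun x => fderiv ℝ (chartMul G) (x, extChartAt 𝓘(ℝ, E) (1 : G) 1) (0, v))
      (extChartAt 𝓘(ℝ, E) (1 : G) 1) w =
    fderiv ℝ (fderiv ℝ (chartMul G))
      (extChartAt 𝓘(ℝ, E) (1 : G) 1, extChartAt 𝓘(ℝ, E) (1 : G) 1) (w, 0) (0, v) := by
  have h3 := HasFDerivAt.comp (f := fun x : E => (x, extChartAt 𝓘(ℝ, E) (1 : G) 1))
    (extChartAt 𝓘(ℝ, E) (1 : G) 1) (hasFDerivAt_fderiv_chartMul G)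
    (hasFDerivAt_prodMk_left (𝕜 := ℝ) _ _)
  have h4 := h3.clm_apply (hasFDerivAt_const ((0, v) : E × E) (extChartAt 𝓘(ℝ, E) (1 : G) 1))
  have h5 : fderiv ℝ (fun x => fderiv ℝ (chartMul G) (x, extChartAt 𝓘(ℝ, E) (1 : G) 1) (0, v))
      (extChartAt 𝓘(ℝ, E) (1 : G) 1) = _ := h4.fderiv
  rw [h5]
  simp

/-- The bracket of the Lie algebra is the antisymmetrised second derivative of the multiplication
in a chart. -/
lemma br_eq_fderiv_chartMul (v w : E) :
    br G v w =
      fderiv ℝ (fderiv ℝ (chartMul G))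
        (extChartAt 𝓘(ℝ, E) (1 : G) 1, extChartAt 𝓘(ℝ, E) (1 : G) 1) (v, 0) (0, w)
      - fderiv ℝ (fderiv ℝ (chartMul G))
        (extChartAt 𝓘(ℝ, E) (1 : G) 1, extChartAt 𝓘(ℝ, E) (1 : G) 1) (w, 0) (0, v) := by
  have : IsManifold 𝓘(ℝ, E) 1 G := IsManifold.of_le (n := ∞) (by simp)
  have h1 : ∀ v : E, fderiv ℝ (chartMul G)
      (extChartAt 𝓘(ℝ, E) (1 : G) 1, extChartAt 𝓘(ℝ, E) (1 : G) 1) (0, v) = v := by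
    intro v
    have hd := (contDiffAt_chartMul (E := E) G).differentiableAt (by simp)
    have hA : HasDerivMap 𝓘(ℝ, E) 𝓘(ℝ, E)
        (fun h => (extChartAt 𝓘(ℝ, E) (1 : G)).symm (extChartAt 𝓘(ℝ, E) (1 : G) 1) * h) 1
        (ContinuousLinearMap.id ℝ E) := by
      rw [extChartAt_to_inv]
      simpa using hasDerivMap_id (1 : G)
    have hB := hasDerivMap_extChartAt_self (E := E) G
    rw [fderiv_chartMul_inr G hd v hA (by rwa [extChartAt_to_inv])]
    rfl
  -- The preferred chart has identity derivative at its centre, so the bracket on the group is the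
  -- bracket of the fields read in the chart, with no correction.
  obtain ⟨A, hA, hbr⟩ : ∃ A : E →L[ℝ] E, A = ContinuousLinearMap.id ℝ E ∧
      br G v w = A.inverse (VectorField.lieBracketWithin ℝ
        (invariantFieldInChart G v)
        (invariantFieldInChart G w)
        ((extChartAt 𝓘(ℝ, E) (1 : G)).symm ⁻¹' Set.univ ∩ Set.range 𝓘(ℝ, E))
        (extChartAt 𝓘(ℝ, E) (1 : G) 1)) :=
    ⟨_, mfderiv_extChartAt_self, VectorField.mlieBracketWithin_apply⟩
  have hset : (extChartAt 𝓘(ℝ, E) (1 : G)).symm ⁻¹' Set.univ ∩ Set.range 𝓘(ℝ, E) = Set.univ := by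
    simp
  rw [hbr, hA, ContinuousLinearMap.inverse_id, hset, VectorField.lieBracketWithin_univ,
    Filter.EventuallyEq.lieBracket_vectorField_eq (eventually_invariantFieldInChart_eq G v)
      (eventually_invariantFieldInChart_eq G w), VectorField.lieBracket_eq]
  simp only [ContinuousLinearMap.id_apply, h1, fderiv_fderiv_chartMul_inr]

/-- This is `g h = (g h g⁻¹) g` differentiated in `h` at `1`: left translation is `Ad_g` followed by
right translation. -/
lemma eventually_fderiv_chartMul_inr_eq (w : E) :
    (fun x => fderiv ℝ (chartMul G) (x, extChartAt 𝓘(ℝ, E) (1 : G) 1) (0, w))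
      =ᶠ[nhds (extChartAt 𝓘(ℝ, E) (1 : G) 1)]
    fun x => fderiv ℝ (chartMul G) (extChartAt 𝓘(ℝ, E) (1 : G) 1, x)
      (Ad ((extChartAt 𝓘(ℝ, E) (1 : G)).symm x) w, 0) := by
  have : IsManifold 𝓘(ℝ, E) 1 G := IsManifold.of_le (n := ∞) (by simp)
  have h := ((contDiffAt_chartMul (E := E) G).of_le (m := 1) (by simp)).eventually (by simp)
  have hc1 : ContinuousAt (fun x : E => (x, extChartAt 𝓘(ℝ, E) (1 : G) 1))
    (extChartAt 𝓘(ℝ, E) (1 : G) 1) := by fun_prop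
  have hc2 : ContinuousAt (fun x : E => (extChartAt 𝓘(ℝ, E) (1 : G) 1, x))
    (extChartAt 𝓘(ℝ, E) (1 : G) 1) := by fun_prop
  filter_upwards [hc1.eventually h, hc2.eventually h, eventually_mem_extChartAt_one_target G]
    with x h1 h2 hxt
  have hsrc := (extChartAt 𝓘(ℝ, E) (1 : G)).map_target hxt
  set g := (extChartAt 𝓘(ℝ, E) (1 : G)).symm x with hg
  have hφ := (mdifferentiableAt_extChartAt (I := 𝓘(ℝ, E)) (x := (1 : G)) (y := g)
    (by simpa using hsrc)).hasDerivMap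
  have hr : MDifferentiableAt 𝓘(ℝ, E) 𝓘(ℝ, E) (fun y : G => y * g) 1 := by
    have : ContMDiff 𝓘(ℝ, E) 𝓘(ℝ, E) ∞ (fun x : G => x * g) := contMDiff_id.mul contMDiff_const
    exact this.mdifferentiableAt (by simp)
  have hR := hφ.comp hr.hasDerivMap (one_mul g)
  have hL := (mdifferentiableAt_mul_left (E := E) g 1).hasDerivMap
  rw [fderiv_chartMul_inr G (h1.differentiableAt (by simp)) w hL hφ,
    fderiv_chartMul_inl G (h2.differentiableAt (by simp)) _ hR]
  have e := hR.comp (hasDerivMap_conj (E := E) g) (by simp)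
  simp only [inv_mul_cancel_right] at e
  exact DFunLike.congr_fun ((hφ.comp hL (mul_one g)).unique e) w

/-- The derivative of the adjoint representation at the identity is the bracket. -/
lemma hasDerivMap_Ad_one :
    ∃ D : E →L[ℝ] E →L[ℝ] E,
      HasDerivMap 𝓘(ℝ, E) 𝓘(ℝ, E →L[ℝ] E) (fun g : G => Ad (E := E) g) 1 D ∧
      ∀ v w, D v w = br G v w := by
  obtain ⟨D, hD⟩ : ∃ D : E →L[ℝ] E →L[ℝ] E,
      HasDerivMap 𝓘(ℝ, E) 𝓘(ℝ, E →L[ℝ] E) (fun g : G => Ad (E := E) g) 1 D :=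
    ⟨_, ((contMDiffAt_Ad_one (E := E) G).mdifferentiableAt (by simp)).hasDerivMap⟩
  refine ⟨D, hD, fun v w => ?_⟩
  set e := extChartAt 𝓘(ℝ, E) (1 : G) 1 with he
  have hAd : HasFDerivAt (fun x : E => Ad (E := E) ((extChartAt 𝓘(ℝ, E) (1 : G)).symm x)) D e := by
    have := hD.comp (hasDerivMap_extChartAt_symm_self G) (extChartAt_to_inv (1 : G))
    exact hasDerivMap_iff_hasFDerivAt.1 this
  have hAdw := (hAd.clm_apply (hasFDerivAt_const w e)).prodMk (hasFDerivAt_const (0 : E) e)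
  have hB := HasFDerivAt.comp (f := fun x : E => (e, x)) e (hasFDerivAt_fderiv_chartMul (E := E) G)
    (hasFDerivAt_prodMk_right (𝕜 := ℝ) _ _)
  have h1 := (hB.clm_apply hAdw).fderiv
  have h2 := Filter.EventuallyEq.fderiv_eq (𝕜 := ℝ) (eventually_fderiv_chartMul_inr_eq G w)
  -- With `m = chartMul G`, differentiating the identity along `v` yields `D²m(v, 0)(0, w) = D²m(0,
  -- v)(w, 0) + D v w`. Symmetry of `D²m` then turns `D v w` into the antisymmetrised expression for
  -- the bracket.
  have h3 := DFunLike.congr_fun (h2.trans h1) v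
  rw [fderiv_fderiv_chartMul_inr] at h3
  have hd := (contDiffAt_chartMul (E := E) G).differentiableAt (by simp)
  have hinl : ∀ u : E, fderiv ℝ (chartMul G) (e, e) (u, 0) = u := by
    intro u
    have hA : HasDerivMap 𝓘(ℝ, E) 𝓘(ℝ, E) (fun h => extChartAt 𝓘(ℝ, E) (1 : G)
        (h * (extChartAt 𝓘(ℝ, E) (1 : G)).symm e)) 1 (ContinuousLinearMap.id ℝ E) := by
      rw [he, extChartAt_to_inv]
      simpa using hasDerivMap_extChartAt_self (E := E) G
    rw [fderiv_chartMul_inl G hd u hA]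
    rfl
  have hsymm : IsSymmSndFDerivAt ℝ (chartMul G) (e, e) :=
    (contDiffAt_chartMul (E := E) G).isSymmSndFDerivAt
      (by rw [minSmoothness_of_isRCLikeNormedField]; exact ENat.LEInfty.out)
  have hw : Ad (E := E) ((extChartAt 𝓘(ℝ, E) (1 : G)).symm e) w = w := by
    rw [he, extChartAt_to_inv, Ad_one (E := E)]; rfl
  rw [br_eq_fderiv_chartMul, h3, ← he, hsymm.eq (w, 0) (0, v), hw]
  simp [hinl]

end AdjointDerivative

/-! ### Derivatives of the coadjoint action and the pullback formula -/

section Coadjoint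

variable {E : Type*} [NormedAddCommGroup E] [NormedSpace ℝ E]
variable (G : Type*) [TopologicalSpace G] [ChartedSpace E G] [Group G]
variable [LieGroup 𝓘(ℝ, E) ∞ G]

/-- The bracket of the Lie algebra as a continuous bilinear map. -/
def brL : E →L[ℝ] E →L[ℝ] E := (hasDerivMap_Ad_one (E := E) G).choose

lemma brL_apply (v w : E) : brL G v w = br G v w :=
  (hasDerivMap_Ad_one (E := E) G).choose_spec.2 v w

lemma hasDerivMap_Ad_brL :
    HasDerivMap 𝓘(ℝ, E) 𝓘(ℝ, E →L[ℝ] E) (fun g : G => Ad (E := E) g) 1 (brL G) :=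
  (hasDerivMap_Ad_one (E := E) G).choose_spec.1

lemma brL_swap (v w : E) : brL G v w = -brL G w v := by
  rw [brL_apply, brL_apply, br_eq_fderiv_chartMul, br_eq_fderiv_chartMul, neg_sub]

variable {G}

/-- Differentiate `Ad_{g x g⁻¹} = Ad_g Ad_x Ad_{g⁻¹}` at `x = 1` along `ξ` and apply the result to
`Ad_g η`. -/
lemma brL_Ad (g : G) (ξ η : E) : brL G (Ad g ξ) (Ad g η) = Ad g (brL G ξ η) := by
  have h1 := (hasDerivMap_Ad_brL (E := E) G).comp (hasDerivMap_conj (E := E) g) (by simp)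
  have h2 := (hasDerivMap_iff_hasFDerivAt.2
    ((ContinuousLinearMap.compL ℝ E E E (Ad g)).comp
      ((ContinuousLinearMap.compL ℝ E E E).flip (Ad g⁻¹))).hasFDerivAt).comp
    (hasDerivMap_Ad_brL (E := E) G) rfl
  have h3 : (fun x : G => Ad (E := E) (g * x * g⁻¹)) = fun x =>
      ((ContinuousLinearMap.compL ℝ E E E (Ad g)).comp
        ((ContinuousLinearMap.compL ℝ E E E).flip (Ad g⁻¹))) (Ad x) := by
    ext x v
    simp [Ad_mul]
  rw [h3] at h1
  have h4 := DFunLike.congr_fun (DFunLike.congr_fun (h1.unique h2) ξ) (Ad g η)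
  simpa using h4

/-- Writing `Ad_{p(y)} = Ad_{p(x)} Ad_{p(x)⁻¹ p(y)}` reduces the derivative at an arbitrary point to
the one at the identity. -/
lemma HasLogDerivAt.Ad {V H M : Type*} [NormedAddCommGroup V] [NormedSpace ℝ V]
    [TopologicalSpace H] {J : ModelWithCorners ℝ V H} [TopologicalSpace M] [ChartedSpace H M]
    {p : M → G} {x : M} {A : V →L[ℝ] E} (hp : HasLogDerivAt J p x A) :
    HasDerivMap J 𝓘(ℝ, E →L[ℝ] E) (fun y => Ad (E := E) (p y)) x
      ((ContinuousLinearMap.compL ℝ E E E (TubeCondition.Ad (p x))).comp ((brL G).comp A)) := by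
  have h1 := (hasDerivMap_iff_hasFDerivAt.2
    (ContinuousLinearMap.compL ℝ E E E (TubeCondition.Ad (p x))).hasFDerivAt).comp
    ((hasDerivMap_Ad_brL (E := E) G).comp hp (by simp)) rfl
  have h2 : (fun y => TubeCondition.Ad (E := E) (p y)) = fun y =>
      ContinuousLinearMap.compL ℝ E E E (TubeCondition.Ad (p x))
        (TubeCondition.Ad ((p x)⁻¹ * p y)) := by
    ext y v
    simp [Ad_mul]
  rwa [h2]

lemma HasLogDerivAt.AdStar {V : Type*} [NormedAddCommGroup V] [NormedSpace ℝ V]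
    {p : V → G} {x : V} {A : V →L[ℝ] E} (hp : HasLogDerivAt 𝓘(ℝ, V) p x A)
    {β : V → StrongDual ℝ E} {B : V →L[ℝ] StrongDual ℝ E} (hβ : HasFDerivAt β B x) :
    ∃ D : V →L[ℝ] StrongDual ℝ E,
      HasFDerivAt (fun y => TubeCondition.AdStar (p y) (β y)) D x ∧
      ∀ v ξ, D v ξ = B v (TubeCondition.Ad (p x) ξ)
        + β x (TubeCondition.Ad (p x) (brL G (A v) ξ)) := by
  have h := hβ.clm_comp (hasDerivMap_iff_hasFDerivAt.1 hp.Ad)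
  refine ⟨_, h, fun v ξ => ?_⟩
  simp [add_comm]

/-- The pullback of the canonical symplectic form by an equivariant map
`(g, y) ↦ (g f(y)⁻¹, Ad_{f(y)⁻¹}^* β(y))`. -/
lemma omegaC_mfderiv {V : Type*} [NormedAddCommGroup V] [NormedSpace ℝ V]
    {Φ : G × V → G × StrongDual ℝ E} {g : G} {y : V}
    (hΦ : MDifferentiableAt (𝓘(ℝ, E).prod 𝓘(ℝ, V)) (𝓘(ℝ, E).prod 𝓘(ℝ, StrongDual ℝ E)) Φ (g, y))
    {f : V → G} {β : V → StrongDual ℝ E} {S : V →L[ℝ] E} {B : V →L[ℝ] StrongDual ℝ E}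
    (hf : MDifferentiableAt 𝓘(ℝ, V) 𝓘(ℝ, E) f y)
    (hS : HasLogDerivAt 𝓘(ℝ, V) f y S) (hβ : HasFDerivAt β B y)
    (heq : ∀ᶠ z in nhds y, ∀ h, Φ (h, z) = (h * (f z)⁻¹, AdStar (f z)⁻¹ (β z)))
    (X₁ X₂ : E × V) :
    omegaC (Φ (g, y))
      (mfderiv (𝓘(ℝ, E).prod 𝓘(ℝ, V)) (𝓘(ℝ, E).prod 𝓘(ℝ, StrongDual ℝ E)) Φ (g, y) X₁)
      (mfderiv (𝓘(ℝ, E).prod 𝓘(ℝ, V)) (𝓘(ℝ, E).prod 𝓘(ℝ, StrongDual ℝ E)) Φ (g, y) X₂)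
    = β y (brL G (leftTrivL g X₁.1) (leftTrivL g X₂.1)) - β y (brL G (S X₁.2) (S X₂.2))
      + B X₂.2 (leftTrivL g X₁.1 - S X₁.2) - B X₁.2 (leftTrivL g X₂.1 - S X₂.2) := by
  obtain ⟨D, hD⟩ : ∃ D : E × V →L[ℝ] E × StrongDual ℝ E,
    HasDerivMap (𝓘(ℝ, E).prod 𝓘(ℝ, V)) (𝓘(ℝ, E).prod 𝓘(ℝ, StrongDual ℝ E)) Φ (g, y) D :=
    ⟨_, hΦ.hasDerivMap⟩
  have hinv : MDifferentiableAt 𝓘(ℝ, V) 𝓘(ℝ, E) (fun z => (f z)⁻¹) y :=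
    ((contMDiff_inv 𝓘(ℝ, E) ∞).mdifferentiableAt (x := f y) (by simp)).comp y hf
  have hA := hinv.hasDerivMap.hasLogDerivAt
  have hA' := hS.inv hA
  rw [hA'] at hA
  obtain ⟨D', hD', hD'v⟩ := hA.AdStar hβ
  have heq' : ∀ᶠ p : G × V in nhds (g, y),
      Φ p = (p.1 * (f p.2)⁻¹, AdStar (f p.2)⁻¹ (β p.2)) :=
    (continuous_snd.continuousAt.eventually heq).mono fun p hp => hp p.1
  have hlog1 := ((hasDerivMap_fst (J := 𝓘(ℝ, E)) (J' := 𝓘(ℝ, V)) (g, y)).hasLogDerivAt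
    (E := E)).mul (hA.comp (hasDerivMap_snd (J := 𝓘(ℝ, E)) (J' := 𝓘(ℝ, V)) (g, y)) rfl)
  have hlog2 : HasLogDerivAt (𝓘(ℝ, E).prod 𝓘(ℝ, V)) (fun p => (Φ p).1) (g, y) _ :=
    ((hasDerivMap_fst _).comp hD rfl).hasLogDerivAt
  have e1 := hlog2.unique (hlog1.congr (heq'.mono fun p hp => by simp only [hp]))
  have hsnd : HasDerivMap (𝓘(ℝ, E).prod 𝓘(ℝ, V)) 𝓘(ℝ, StrongDual ℝ E) (fun p => (Φ p).2) (g, y) _ :=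
    (hasDerivMap_snd _).comp hD rfl
  have e2 := hsnd.unique (((hasDerivMap_iff_hasFDerivAt.2 hD').comp
    (hasDerivMap_snd (J := 𝓘(ℝ, E)) (J' := 𝓘(ℝ, V)) (g, y)) rfl).congr
    (heq'.mono fun p hp => by simp only [hp]))
  -- The logarithmic derivative of `f⁻¹` is `-Ad_f S`, so that of `g f⁻¹` is `Ad_f (ξ - S v)`.
  -- Everything is therefore evaluated on vectors of the form `Ad_f ξ`, where the twist by
  -- `Ad_{f⁻¹}^*` cancels.
  have k1 : ∀ X : E × V, leftTrivL (Φ (g, y)).1 (D X).1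
      = Ad (f y) (leftTrivL g X.1 - S X.2) := fun X => by
    have := DFunLike.congr_fun e1 X
    simp only [inv_inv] at this
    simpa [sub_eq_add_neg] using this
  have k2 : ∀ (X : E × V) (ξ : E), (D X).2 (Ad (f y) ξ) = B X.2 ξ - β y (brL G (S X.2) ξ) := by
    intro X ξ
    have h1 : (D X).2 = D' X.2 := by simpa using DFunLike.congr_fun e2 X
    rw [h1, hD'v]
    simp [← brL_Ad, sub_eq_add_neg]
  have k3 : ∀ ξ, (Φ (g, y)).2 (Ad (f y) ξ) = β y ξ := by
    intro ξ
    rw [heq.self_of_nhds g]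
    simp [AdStar_apply]
  rw [hD.mfderiv_eq]
  change (Φ (g, y)).2 (br G (leftTrivL (Φ (g, y)).1 (D X₁).1) (leftTrivL (Φ (g, y)).1 (D X₂).1))
    + (D X₂).2 (leftTrivL (Φ (g, y)).1 (D X₁).1) - (D X₁).2 (leftTrivL (Φ (g, y)).1 (D X₂).1) = _
  -- On expanding, antisymmetry cancels the mixed terms `β[ξᵢ, S vⱼ]`, and the three multiples of
  -- `β[S v₁, S v₂]` add up to a single one with sign `-1`.
  rw [k1, k1, k2, k2, ← brL_apply, brL_Ad, k3]
  simp only [map_sub, sub_apply]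
  rw [brL_swap G (S X₂.2) (leftTrivL g X₁.1), brL_swap G (S X₂.2) (S X₁.2), map_neg, map_neg]
  ring

end Coadjoint

/-! ### Equivariant maps along the slice and the tube equation -/

section Tube

variable {E : Type*} [NormedAddCommGroup E] [NormedSpace ℝ E]
variable {G : Type*} [TopologicalSpace G] [ChartedSpace E G] [Group G]
variable [LieGroup 𝓘(ℝ, E) ∞ G]

/-- The inverse of the group component of `Φ` along the slice at the identity. -/
def sliceGroup {V : Type*} (Φ : G × V → G × StrongDual ℝ E) (y : V) : G := (Φ (1, y)).1⁻¹

/-- The coadjoint component of `Φ` along the slice, moved back by `sliceGroup Φ`. -/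
def sliceMomentum {V : Type*} (Φ : G × V → G × StrongDual ℝ E) (y : V) : StrongDual ℝ E :=
  AdStar (sliceGroup Φ y) (Φ (1, y)).2

lemma eq_sliceGroup_sliceMomentum {V : Type*} {U : Set V}
    {Φ : G × V → G × StrongDual ℝ E}
    (hequiv : ∀ h g : G, ∀ y ∈ U, Φ (h * g, y) = (h * (Φ (g, y)).1, (Φ (g, y)).2))
    {y : V} (hy : y ∈ U) (h : G) :
    Φ (h, y) = (h * (sliceGroup Φ y)⁻¹, AdStar (sliceGroup Φ y)⁻¹ (sliceMomentum Φ y)) := by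
  have h1 := hequiv h 1 y hy
  rw [mul_one] at h1
  rw [h1]
  refine Prod.ext (by simp [sliceGroup]) ?_
  ext ξ
  simp [sliceMomentum, AdStar_apply]

section Slice

variable {V : Type*} [NormedAddCommGroup V] [NormedSpace ℝ V] {U : Set V}
  {Φ : G × V → G × StrongDual ℝ E}

lemma contMDiffOn_sliceGroup
    (hΦ : ContMDiffOn (𝓘(ℝ, E).prod 𝓘(ℝ, V)) (𝓘(ℝ, E).prod 𝓘(ℝ, StrongDual ℝ E)) ∞ Φ
      (Set.univ ×ˢ U)) :
    ContMDiffOn 𝓘(ℝ, V) 𝓘(ℝ, E) ∞ (sliceGroup Φ) U := by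
  have h1 : ContMDiffOn 𝓘(ℝ, V) (𝓘(ℝ, E).prod 𝓘(ℝ, StrongDual ℝ E)) ∞ (fun y => Φ (1, y)) U :=
    hΦ.comp (contMDiff_const.prodMk contMDiff_id).contMDiffOn fun y hy => ⟨trivial, hy⟩
  exact (contMDiff_fst.comp_contMDiffOn h1).inv

/-- The product rule for `AdStar` along a differentiable curve of group elements applies;
first-order regularity suffices for comparing the forms. -/
lemma differentiableAt_sliceMomentum (hU : IsOpen U)
    (hΦ : ContMDiffOn (𝓘(ℝ, E).prod 𝓘(ℝ, V)) (𝓘(ℝ, E).prod 𝓘(ℝ, StrongDual ℝ E)) ∞ Φ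
      (Set.univ ×ˢ U)) {y : V} (hy : y ∈ U) : DifferentiableAt ℝ (sliceMomentum Φ) y := by
  have h1 : ContMDiffOn 𝓘(ℝ, V) (𝓘(ℝ, E).prod 𝓘(ℝ, StrongDual ℝ E)) ∞ (fun y => Φ (1, y)) U :=
    hΦ.comp (contMDiff_const.prodMk contMDiff_id).contMDiffOn fun y hy => ⟨trivial, hy⟩
  have h2 : ContMDiffAt 𝓘(ℝ, V) 𝓘(ℝ, StrongDual ℝ E) ∞ (fun y => (Φ (1, y)).2) y :=
    (contMDiff_snd.comp_contMDiffOn h1).contMDiffAt (hU.mem_nhds hy)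
  have h3 := ((contMDiffOn_sliceGroup hΦ).contMDiffAt (hU.mem_nhds hy)).mdifferentiableAt
    (by simp)
  obtain ⟨D, hD, -⟩ := h3.hasDerivMap.hasLogDerivAt.AdStar
    ((contMDiffAt_iff_contDiffAt.1 h2).differentiableAt (by simp)).hasFDerivAt
  exact hD.differentiableAt

/-- An equivariant map pulls the canonical symplectic form back to a form of
Marle-Guillemin-Sternberg type iff its momentum along the slice is `μ + L y` and the logarithmic
derivative of its group component satisfies the tube equation. -/
lemma pullback_omegaC_eq_iff (hU : IsOpen U) (hUc : IsPreconnected U) (hU0 : (0 : V) ∈ U)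
    (hΦ : ContMDiffOn (𝓘(ℝ, E).prod 𝓘(ℝ, V)) (𝓘(ℝ, E).prod 𝓘(ℝ, StrongDual ℝ E)) ∞ Φ
      (Set.univ ×ˢ U))
    (hequiv : ∀ h g : G, ∀ y ∈ U, Φ (h * g, y) = (h * (Φ (g, y)).1, (Φ (g, y)).2))
    {μ : StrongDual ℝ E} (hbase : Φ (1, 0) = (1, μ))
    (L : V →L[ℝ] StrongDual ℝ E) (κ : V → V → ℝ) (hκ : ∀ v, κ 0 v = 0) :
    (∀ g : G, ∀ y ∈ U, ∀ X₁ X₂ : E × V,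
      omegaC (Φ (g, y))
        (mfderiv (𝓘(ℝ, E).prod 𝓘(ℝ, V)) (𝓘(ℝ, E).prod 𝓘(ℝ, StrongDual ℝ E)) Φ (g, y) X₁)
        (mfderiv (𝓘(ℝ, E).prod 𝓘(ℝ, V)) (𝓘(ℝ, E).prod 𝓘(ℝ, StrongDual ℝ E)) Φ (g, y) X₂)
      = (μ + L y) (brL G (leftTrivL g X₁.1) (leftTrivL g X₂.1))
        + L X₂.2 (leftTrivL g X₁.1) - L X₁.2 (leftTrivL g X₂.1) - κ X₁.2 X₂.2) ↔
    (∀ y ∈ U, sliceMomentum Φ y = μ + L y) ∧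
      ∀ y ∈ U, ∀ S : V →L[ℝ] E, HasLogDerivAt 𝓘(ℝ, V) (sliceGroup Φ) y S → ∀ v₁ v₂ : V,
        (μ + L y) (brL G (S v₁) (S v₂)) + L v₂ (S v₁) - L v₁ (S v₂) = κ v₁ v₂ := by
  have hf : ∀ y ∈ U, MDifferentiableAt 𝓘(ℝ, V) 𝓘(ℝ, E) (sliceGroup Φ) y := fun y hy =>
    ((contMDiffOn_sliceGroup hΦ).contMDiffAt (hU.mem_nhds hy)).mdifferentiableAt (by simp)
  have hβ : ∀ y ∈ U, DifferentiableAt ℝ (sliceMomentum Φ) y := fun y hy =>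
    differentiableAt_sliceMomentum hU hΦ hy
  have hΦd : ∀ g : G, ∀ y ∈ U, MDifferentiableAt (𝓘(ℝ, E).prod 𝓘(ℝ, V))
      (𝓘(ℝ, E).prod 𝓘(ℝ, StrongDual ℝ E)) Φ (g, y) := fun g y hy =>
    (hΦ.contMDiffAt ((isOpen_univ.prod hU).mem_nhds ⟨trivial, hy⟩)).mdifferentiableAt (by simp)
  have hform : ∀ y ∈ U, ∀ᶠ z in nhds y, ∀ h, Φ (h, z)
      = (h * (sliceGroup Φ z)⁻¹, AdStar (sliceGroup Φ z)⁻¹ (sliceMomentum Φ z)) := fun y hy =>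
    Filter.mem_of_superset (hU.mem_nhds hy) fun z hz h => eq_sliceGroup_sliceMomentum hequiv hz h
  have hformula := fun (g : G) (y : V) (hy : y ∈ U) (S : V →L[ℝ] E)
    (hS : HasLogDerivAt 𝓘(ℝ, V) (sliceGroup Φ) y S) (X₁ X₂ : E × V) =>
    omegaC_mfderiv (hΦd g y hy) (hf y hy) hS (hβ y hy).hasFDerivAt (hform y hy) X₁ X₂
  have hL : ∀ y, HasFDerivAt (fun y => μ + L y) L y := fun y => L.hasFDerivAt.const_add μ
  constructor
  · intro h
    have hder : ∀ y ∈ U, fderiv ℝ (sliceMomentum Φ) y = L := by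
      intro y hy
      have hS := (hf y hy).hasDerivMap.hasLogDerivAt
      ext v ξ
      obtain ⟨ξ', rfl⟩ := (leftTrivL_bijective (E := E) (1 : G)).2 ξ
      -- One group direction against one slice direction: the bracket terms and `κ` vanish, leaving
      -- `(Dβ v) ξ = (L v) ξ`.
      have h2 := (hformula 1 y hy _ hS (ξ', 0) (0, v)).symm.trans (h 1 y hy (ξ', 0) (0, v))
      simpa [hκ] using h2
    have hmom : ∀ y ∈ U, sliceMomentum Φ y = μ + L y := by
      intro y hy
      have hd : ∀ z ∈ U, HasFDerivAt (fun z => sliceMomentum Φ z - (μ + L z))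
          (0 : V →L[ℝ] StrongDual ℝ E) z := by
        intro z hz
        have := (hβ z hz).hasFDerivAt.sub (hL z)
        rwa [hder z hz, sub_self] at this
      -- Connectedness enters here: `β - (μ + L)` has zero derivative, and it vanishes at the base
      -- point.
      have hc := hU.is_const_of_fderiv_eq_zero hUc
        (fun z hz => (hd z hz).differentiableAt.differentiableWithinAt)
        (fun z hz => (hd z hz).fderiv) hy hU0
      have h0 : sliceMomentum Φ 0 = μ := by
        ext ξ
        simp [sliceMomentum, sliceGroup, AdStar, hbase, Ad_one]
      rw [← sub_eq_zero, hc, h0]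
      simp
    refine ⟨hmom, fun y hy S hS v₁ v₂ => ?_⟩
    -- On two slice directions only the terms in `S` and `κ` survive; up to sign this is the tube
    -- equation.
    have h2 := (hformula 1 y hy S hS (0, v₁) (0, v₂)).symm.trans (h 1 y hy (0, v₁) (0, v₂))
    rw [hder y hy, hmom y hy] at h2
    simp at h2 ⊢
    linarith
  · rintro ⟨hmom, htube⟩ g y hy X₁ X₂
    have hS := (hf y hy).hasDerivMap.hasLogDerivAt
    have hder : fderiv ℝ (sliceMomentum Φ) y = L :=
      ((hL y).congr_of_eventuallyEq (Filter.mem_of_superset (hU.mem_nhds hy) hmom)).fderiv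
    rw [hformula g y hy _ hS X₁ X₂, hder, hmom y hy, ← htube y hy _ hS X₁.2 X₂.2]
    simp only [map_sub, add_apply]
    ring

end Slice

/-! ### Passing from `N` to the complement `𝔤_μ^⊥` -/

section Parametrisation

variable {A W N : Type*} [NormedAddCommGroup A] [NormedSpace ℝ A]
  [NormedAddCommGroup W] [NormedSpace ℝ W] [FiniteDimensional ℝ W]
  [NormedAddCommGroup N] [NormedSpace ℝ N]

/-- `pullback_omegaC_eq_iff`, with the slice `A × N` parametrised by `A × W`. -/
lemma pullback_omegaC_eq_iff_exists (e : W ≃ₗ[ℝ] N) {U : Set (A × N)}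
    (hU : IsOpen U) (hUc : IsPreconnected U) (hU0 : (0 : A × N) ∈ U)
    {Φ : G × (A × N) → G × StrongDual ℝ E}
    (hΦ : ContMDiffOn (𝓘(ℝ, E).prod 𝓘(ℝ, A × N)) (𝓘(ℝ, E).prod 𝓘(ℝ, StrongDual ℝ E)) ∞ Φ
      (Set.univ ×ˢ U))
    (hequiv : ∀ h g : G, ∀ y ∈ U, Φ (h * g, y) = (h * (Φ (g, y)).1, (Φ (g, y)).2))
    {μ : StrongDual ℝ E} (hbase : Φ (1, 0) = (1, μ))
    (L : A →L[ℝ] StrongDual ℝ E) (κ : W → W → ℝ) (hκ : ∀ v, κ 0 v = 0) :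
    (∀ g : G, ∀ y ∈ U, ∀ X₁ X₂ : E × (A × N),
      omegaC (Φ (g, y))
        (mfderiv (𝓘(ℝ, E).prod 𝓘(ℝ, A × N)) (𝓘(ℝ, E).prod 𝓘(ℝ, StrongDual ℝ E)) Φ (g, y) X₁)
        (mfderiv (𝓘(ℝ, E).prod 𝓘(ℝ, A × N)) (𝓘(ℝ, E).prod 𝓘(ℝ, StrongDual ℝ E)) Φ (g, y) X₂)
      = (μ + L y.1) (brL G (leftTrivL g X₁.1) (leftTrivL g X₂.1))
        + L X₂.2.1 (leftTrivL g X₁.1) - L X₁.2.1 (leftTrivL g X₂.1)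
        - κ (e.symm X₁.2.2) (e.symm X₂.2.2)) ↔
    ∃ F : A × W → G,
      ContMDiffOn 𝓘(ℝ, A × W) 𝓘(ℝ, E) ∞ F {x | (x.1, e x.2) ∈ U} ∧
      (∀ g : G, ∀ x : A × W, (x.1, e x.2) ∈ U →
        Φ (g, (x.1, e x.2)) = (g * (F x)⁻¹, AdStar (F x)⁻¹ (μ + L x.1))) ∧
      F (0, 0) = 1 ∧
      ∀ x : A × W, (x.1, e x.2) ∈ U → ∀ v₁ v₂ : A × W,
        (μ + L x.1) (brL G
            (leftTrivL (E := E) (F x) (mfderiv 𝓘(ℝ, A × W) 𝓘(ℝ, E) F x v₁))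
            (leftTrivL (E := E) (F x) (mfderiv 𝓘(ℝ, A × W) 𝓘(ℝ, E) F x v₂)))
          + L v₂.1 (leftTrivL (E := E) (F x) (mfderiv 𝓘(ℝ, A × W) 𝓘(ℝ, E) F x v₁))
          - L v₁.1 (leftTrivL (E := E) (F x) (mfderiv 𝓘(ℝ, A × W) 𝓘(ℝ, E) F x v₂))
        = κ v₁.2 v₂.2 := by
  set ψ : (A × W) ≃L[ℝ] (A × N) :=
    (ContinuousLinearEquiv.refl ℝ A).prodCongr e.toContinuousLinearEquiv with hψ
  have hψa : ∀ x, ψ x = (x.1, e x.2) := fun x => rfl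
  have hψd : ∀ x, HasDerivMap 𝓘(ℝ, A × W) 𝓘(ℝ, A × N) ψ x (ψ : (A × W) →L[ℝ] (A × N)) :=
    fun x => ψ.hasMFDerivAt
  have hV : IsOpen {x : A × W | (x.1, e x.2) ∈ U} := hU.preimage ψ.continuous
  have hf : ∀ y ∈ U, MDifferentiableAt 𝓘(ℝ, A × N) 𝓘(ℝ, E) (sliceGroup Φ) y := fun y hy =>
    ((contMDiffOn_sliceGroup hΦ).contMDiffAt (hU.mem_nhds hy)).mdifferentiableAt (by simp)
  -- Agreement on an open set is agreement of germs, so the chain rule through the linear map `ψ`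
  -- computes the logarithmic derivative of `F`.
  have hlog : ∀ F : A × W → G, (∀ x : A × W, (x.1, e x.2) ∈ U → F x = sliceGroup Φ (ψ x)) →
      ∀ x : A × W, (x.1, e x.2) ∈ U → ∀ S : A × N →L[ℝ] E,
        HasLogDerivAt 𝓘(ℝ, A × N) (sliceGroup Φ) (ψ x) S → ∀ v : A × W,
        leftTrivL (E := E) (F x) (mfderiv 𝓘(ℝ, A × W) 𝓘(ℝ, E) F x v) = S (v.1, e v.2) := by
    intro F hF x hx S hS v
    have hev : F =ᶠ[nhds x] fun z => sliceGroup Φ (ψ z) :=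
      Filter.mem_of_superset (hV.mem_nhds hx) hF
    have hFd := ((hf (ψ x) hx).hasDerivMap.comp (hψd x) rfl).congr hev
    rw [hFd.mfderiv_eq]
    exact DFunLike.congr_fun
      (hFd.hasLogDerivAt.unique ((hS.comp (hψd x) rfl).congr hev)) v
  refine Iff.trans (pullback_omegaC_eq_iff hU hUc hU0 hΦ hequiv hbase
    (L.comp (ContinuousLinearMap.fst ℝ A N)) (fun v w => κ (e.symm v.2) (e.symm w.2))
    (by simp [hκ])) ?_
  constructor
  · rintro ⟨hmom, htube⟩
    refine ⟨fun x => sliceGroup Φ (ψ x),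
      (contMDiffOn_sliceGroup hΦ).comp ψ.contDiff.contMDiff.contMDiffOn fun x hx => hx,
      fun g x hx => ?_, ?_, fun x hx v₁ v₂ => ?_⟩
    · rw [eq_sliceGroup_sliceMomentum hequiv hx g, hmom _ hx]
      rfl
    · change (Φ (1, ψ 0)).1⁻¹ = 1
      simp [hbase]
    · have hS := (hf (ψ x) hx).hasDerivMap.hasLogDerivAt
      have h := htube _ hx _ hS (ψ v₁) (ψ v₂)
      have h' := hlog _ (fun _ _ => rfl) x hx _ hS
      rw [h' v₁, h' v₂]
      simpa [hψa] using h
  · rintro ⟨F, -, hform, -, htube⟩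
    -- The normal form at `g = 1` has group component `F(x)⁻¹`, so `F` is determined by `Φ` on the
    -- parameter domain.
    have hF : ∀ x : A × W, (x.1, e x.2) ∈ U → F x = sliceGroup Φ (ψ x) := by
      intro x hx
      simp [sliceGroup, hψa, hform 1 x hx]
    have hsurj : ∀ y, ∃ x, ψ x = y := ψ.surjective
    constructor
    · intro y hy
      obtain ⟨x, rfl⟩ := hsurj y
      have h1 : (Φ (1, ψ x)).2 = _ := congrArg Prod.snd (hform 1 x hy)
      ext ξ
      rw [sliceMomentum, h1, ← hF x hy]
      simp [AdStar_apply, hψa]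
    · intro y hy S hS w₁ w₂
      obtain ⟨x, rfl⟩ := hsurj y
      obtain ⟨v₁, rfl⟩ := hsurj w₁
      obtain ⟨v₂, rfl⟩ := hsurj w₂
      have h := htube x hy v₁ v₂
      rw [hlog F hF x hy S hS v₁, hlog F hF x hy S hS v₂] at h
      simpa [hψa] using h

end Parametrisation

/-! ### The Marle–Guillemin–Sternberg form -/

section Model

variable [FiniteDimensional ℝ E] {μ : StrongDual ℝ E} {P : Submodule ℝ E}

/-- `extend` as a continuous linear map. -/
def extendL (hP : IsCompl (isotropy G μ) P) :
    StrongDual ℝ (isotropy G μ) →L[ℝ] StrongDual ℝ E :=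
  (ContinuousLinearMap.compL ℝ E (isotropy G μ) ℝ).flip
    (LinearMap.toContinuousLinearMap ((isotropy G μ).projectionOnto P hP))

/-- Collecting the `μ` and `ν` bracket terms and absorbing the projection to `𝔤_μ` into `extend`
brings the model form to the shape compared in `pullback_omegaC_eq_iff`. -/
lemma omegaY_apply (hP : IsCompl (isotropy G μ) P) (g : G) (y : Slice G μ)
    (X₁ X₂ : E × Slice G μ) :
    omegaY hP (g, y) X₁ X₂ = (μ + extend hP y.1) (brL G (leftTrivL g X₁.1) (leftTrivL g X₂.1))
      + extend hP X₂.2.1 (leftTrivL g X₁.1) - extend hP X₁.2.1 (leftTrivL g X₂.1)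
      - μ (brL G ((normalEquiv hP).symm X₁.2.2 : E) ((normalEquiv hP).symm X₂.2.2 : E)) := by
  rw [brL_apply, brL_apply, add_apply]
  change μ (br G (leftTrivL g X₁.1) (leftTrivL g X₂.1))
    + (extend hP y.1 (br G (leftTrivL g X₁.1) (leftTrivL g X₂.1))
      + extend hP X₂.2.1 (leftTrivL g X₁.1) - extend hP X₁.2.1 (leftTrivL g X₂.1))
    + -μ (br G ((normalEquiv hP).symm X₁.2.2 : E) ((normalEquiv hP).symm X₂.2.2 : E)) = _
  ring

end Model

end Tube

end

end TubeCondition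

open TubeCondition in
theorem proposition2p1
    {E : Type*} [NormedAddCommGroup E] [NormedSpace ℝ E] [FiniteDimensional ℝ E]
    {G : Type*} [TopologicalSpace G] [ChartedSpace E G] [Group G] [LieGroup 𝓘(ℝ, E) ∞ G]
    (μ : StrongDual ℝ E)
    (P : Submodule ℝ E) (hP : IsCompl (isotropy G μ) P)
    (U : Set (Slice G μ)) (hU : IsOpen U) (hUc : IsPreconnected U) (hU0 : (0, 0) ∈ U)
    (Φ : G × Slice G μ → G × StrongDual ℝ E)
    (hΦ : ContMDiffOn (𝓘(ℝ, E).prod 𝓘(ℝ, Slice G μ)) (𝓘(ℝ, E).prod 𝓘(ℝ, StrongDual ℝ E)) ∞ Φ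
      (Set.univ ×ˢ U))
    (hequiv : ∀ h g : G, ∀ y ∈ U, Φ (h * g, y) = (h * (Φ (g, y)).1, (Φ (g, y)).2))
    (hbase : Φ (1, (0, 0)) = (1, μ)) :
    (∀ p ∈ (Set.univ : Set G) ×ˢ U,
      ∀ X₁ X₂ : TangentSpace (𝓘(ℝ, E).prod 𝓘(ℝ, Slice G μ)) p,
        omegaC (Φ p)
          (mfderiv (𝓘(ℝ, E).prod 𝓘(ℝ, Slice G μ)) (𝓘(ℝ, E).prod 𝓘(ℝ, StrongDual ℝ E)) Φ p X₁)
          (mfderiv (𝓘(ℝ, E).prod 𝓘(ℝ, Slice G μ)) (𝓘(ℝ, E).prod 𝓘(ℝ, StrongDual ℝ E)) Φ p X₂)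
        = omegaY hP p X₁ X₂) ↔
    ∃ F : StrongDual ℝ (isotropy G μ) × P → G,
      ContMDiffOn 𝓘(ℝ, StrongDual ℝ (isotropy G μ) × P) 𝓘(ℝ, E) ∞ F (paramDomain P U) ∧
      (∀ g : G, ∀ x ∈ paramDomain P U,
        Φ (g, (x.1, toNormal G μ P x.2))
          = (g * (F x)⁻¹, AdStar (F x)⁻¹ (μ + extend hP x.1))) ∧
      F (0, 0) = 1 ∧
      ∀ x ∈ paramDomain P U, ∀ v₁ v₂ : StrongDual ℝ (isotropy G μ) × P,
        (μ + extend hP x.1) (br G (leftLogDeriv F x v₁) (leftLogDeriv F x v₂))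
          + extend hP v₂.1 (leftLogDeriv F x v₁) - extend hP v₁.1 (leftLogDeriv F x v₂)
        = μ (br G (v₁.2 : E) (v₂.2 : E)) := by
  have general := @pullback_omegaC_eq_iff_exists E _ _ G _ _ _ _ (StrongDual ℝ (isotropy G μ))
    P (normalSpace G μ) _ _ _ _ _ _ _ (normalEquiv hP) U
  -- The model form corresponds to `L = extendL hP` and `κ(v, w) = μ[v, w]` on `𝔤_μ^⊥`.
  have key := @general hU hUc hU0 Φ hΦ hequiv μ hbase
    (extendL hP) (fun v w => μ (brL G (v : E) (w : E))) (by simp)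
  refine Iff.trans ?_ (key.trans ?_)
  · constructor
    · intro h g y hy X₁ X₂
      exact (h (g, y) ⟨trivial, hy⟩ X₁ X₂).trans (omegaY_apply hP g y X₁ X₂)
    · rintro h ⟨g, y⟩ ⟨-, hy⟩ X₁ X₂
      exact (h g y hy X₁ X₂).trans (omegaY_apply hP g y X₁ X₂).symm
  · refine exists_congr fun F => and_congr Iff.rfl (and_congr Iff.rfl (and_congr Iff.rfl ?_))
    refine forall_congr' fun x => forall_congr' fun hx => forall_congr' fun v₁ =>
      forall_congr' fun v₂ => ?_
    rw [brL_apply, brL_apply]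
    exact Iff.rfl
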